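/- Let $\mathcal H=(V,\mathcal E)$ be a finite hypergraph (a finite vertex set $V$ and a set $\mathcal E$ of nonempty subsets of $V$, the hyperedges). For a positive integer $L$ put $[L]=\{1,\dots,L\}$. A coloring $C:V\to[L]$ is conflict-free for a hyperedge $E\in\mathcal E$ if there is a vertex $v\in E$ such that $C(u)\neq C(v)$ for all $u\in E\setminus\{v\}$. A conflict-free collection of colorings of $\mathcal H$ is a finite family $C^1,\dots,C^P$ ($P\ge 1$) of colorings $C^p:V\to[L_p]$, with positive integers $L_1,\dots,L_P$, such that for every $E\in\mathcal E$ at least one $C^p$ is conflict-free for $E$. The conflict-free covering number $\alpha_{CF}(\mathcal H)$ is the minimum of $\sum_{p=1}^P L_p$ over all conflict-free collections of colorings of $\mathcal H$. Theorem. There is an absolute constant $K>0$ such that, for every real number $\Gamma>e$ and every finite hypergraph $\mathcal H$ in which each hyperedge intersects at most $\Gamma$ other hyperedges, $$\alpha_{CF}(\mathcal H)\le K\,(\log\Gamma)^2,$$ where $\log$ is the natural logarithm. That is, $\alpha_{CF}(\mathcal H)=O(\log^2\Gamma)$. -/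

import Mathlib

namespace Hypergraph

/-- A `k`-fold coloring of `H` with `L` colors: each vertex receives a `k`-element subset
of the color set `[L]`. -/
abbrev FoldColoring {V : Type*} (H : Hypergraph V) (k L : ℕ) : Type _ :=
  H.vertexSet → {S : Finset (Fin L) // S.card = k}

/-- The `k`-fold coloring `C` is conflict-free for `E`: some vertex `v` of `E` has a color set
disjoint from the color set of every other vertex of `E`. -/
def FoldColoring.IsConflictFreeFor {V : Type*} {H : Hypergraph V} {k L : ℕ}
    (C : H.FoldColoring k L) (E : Set V) : Prop :=
  ∃ v : H.vertexSet, (v : V) ∈ E ∧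
    ∀ w : H.vertexSet, (w : V) ∈ E → w ≠ v → Disjoint (C v).1 (C w).1

/-- A conflict-free collection of `k`-fold colorings `C 0, …, C (P - 1)` of `H`, where `C p` uses
`L p` colors (the number of colorings and the numbers of colors are positive integers):
for every hyperedge, at least one coloring of the collection is conflict-free. -/
structure ConflictFreeCollection {V : Type*} (H : Hypergraph V) (k : ℕ) where
  P : ℕ
  P_pos : 0 < P
  L : Fin P → ℕ
  L_pos : ∀ p, 0 < L p
  C : ∀ p : Fin P, H.FoldColoring k (L p)
  conflictFree : ∀ E ∈ H.edgeSet, ∃ p : Fin P, (C p).IsConflictFreeFor E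

/-- The total number of colors of a conflict-free collection. -/
def ConflictFreeCollection.totalColors {V : Type*} {H : Hypergraph V} {k : ℕ}
    (𝒞 : H.ConflictFreeCollection k) : ℕ :=
  ∑ p, 𝒞.L p

/-- The `k`-fold conflict-free covering number: the minimum total number of colors over all
conflict-free collections of `k`-fold colorings (it is `⊤` if there is no such collection). -/
noncomputable def foldCFCoveringNumber {V : Type*} (H : Hypergraph V) (k : ℕ) : ℕ∞ :=
  ⨅ 𝒞 : H.ConflictFreeCollection k, (𝒞.totalColors : ℕ∞)

/-- The conflict-free covering number, i.e. the case `k = 1`. -/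
noncomputable def cfCoveringNumber {V : Type*} (H : Hypergraph V) : ℕ∞ :=
  H.foldCFCoveringNumber 1

/-- The hyperedges of `H` other than `E` that intersect `E`. -/
def otherIntersecting {V : Type*} (H : Hypergraph V) (E : Set V) : Set (Set V) :=
  {F | F ∈ H.edgeSet ∧ F ≠ E ∧ (E ∩ F).Nonempty}

end Hypergraph

/-! Two colors per coloring suffice: mark some vertices, and an edge with exactly one marked vertex
is served. So `O(log² Γ)` random markings are wanted, each edge being served by one of them. Edges
may be arbitrarily large, so vertices outside a minimal transversal `U` are never marked. By
minimality each vertex of `U` has a private edge, hence an edge meets `U` in at most `Γ + 1`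
vertices. The sizes of the traces `E ∩ U` then fall into `O(log Γ)` dyadic classes. Within the class
of size about `2 ^ k`, marking with probability `2 ^ (-k - 2)` serves a given trace with probability
at least `1 / 8`. After `O(log Γ)` independent rounds it fails with probability at most `1 / (4d)`,
where `d = ⌊Γ⌋₊`, and the local lemma makes all traces of the class succeed at once. -/

/-! ### Lovász local lemma by counting -/

/-- Events determined by complementary sets of coordinates are independent under the uniform
measure on `W → α`. -/
theorem card_inter_mul_card_univ_of_determined {W α : Type*} [Fintype W] [DecidableEq W]
    [Fintype α] [DecidableEq α] (T : Finset W) (A B : Finset (W → α))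
    (hA : ∀ x y : W → α, (∀ v ∈ T, x v = y v) → x ∈ A → y ∈ A)
    (hB : ∀ x y : W → α, (∀ v ∉ T, x v = y v) → x ∈ B → y ∈ B) :
    (A ∩ B).card * Fintype.card (W → α) = A.card * B.card := by
  rw [← Finset.card_univ, ← Finset.card_product, ← Finset.card_product]
  -- Exchanging the coordinates outside `T` between two points is an involution, carrying `(A ∩ B) ×
  -- univ` onto `A × B`.
  refine Finset.card_nbij' (fun z => (T.piecewise z.1 z.2, T.piecewise z.2 z.1))
    (fun z => (T.piecewise z.1 z.2, T.piecewise z.2 z.1)) ?_ ?_ ?_ ?_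
  · rintro ⟨x, y⟩ h
    simp only [Finset.coe_product, Finset.coe_inter, Set.mem_prod, Set.mem_inter_iff,
      Finset.mem_coe] at h ⊢
    exact ⟨hA x _ (fun v hv => by simp [hv]) h.1.1, hB x _ (fun v hv => by simp [hv]) h.1.2⟩
  · rintro ⟨x, y⟩ h
    simp only [Finset.coe_product, Finset.coe_inter, Set.mem_prod, Set.mem_inter_iff,
      Finset.mem_coe] at h ⊢
    exact ⟨⟨hA x _ (fun v hv => by simp [hv]) h.1, hB y _ (fun v hv => by simp [hv]) h.2⟩,
      Finset.mem_univ _⟩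
  · rintro ⟨x, y⟩ -
    ext v <;> by_cases hv : v ∈ T <;> simp [hv]
  · rintro ⟨x, y⟩ -
    ext v <;> by_cases hv : v ∈ T <;> simp [hv]

/-- The symmetric Lovász local lemma for the uniform measure on a finite product space. -/
theorem exists_forall_notMem_of_card_le {ι W α : Type*} [DecidableEq ι] [Fintype W]
    [DecidableEq W] [Fintype α] [DecidableEq α] [Nonempty α] (S : Finset ι) (T : ι → Finset W)
    (B : ι → Finset (W → α))
    (hB : ∀ i, ∀ x y : W → α, (∀ v ∈ T i, x v = y v) → x ∈ B i → y ∈ B i)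
    (d : ℕ) (hd : 0 < d)
    (hdeg : ∀ i ∈ S, (S.filter fun j => j ≠ i ∧ ¬ Disjoint (T i) (T j)).card ≤ d)
    (hp : ∀ i ∈ S, 4 * d * (B i).card ≤ Fintype.card (W → α)) :
    ∃ x : W → α, ∀ i ∈ S, x ∉ B i := by
  let N : Finset ι → Finset (W → α) := fun A => Finset.univ.filter fun x => ∀ i ∈ A, x ∉ B i
  have memN : ∀ A x, x ∈ N A ↔ ∀ i ∈ A, x ∉ B i := fun A x => by simp [N]
  have hd' : (1 : ℝ) ≤ d := by exact_mod_cast hd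
  have hM : (0 : ℝ) < Fintype.card (W → α) := by exact_mod_cast Fintype.card_pos
  -- Bernoulli gives `q ^ d ≥ 1 / 2`: avoiding at most `d` neighbours costs a factor 2, which turns
  -- the bound `1 / (4d)` into a conditional one of `1 / (2d) = 1 - q`.
  obtain ⟨q, hq⟩ : ∃ q : ℝ, q = 1 - 1 / (2 * d) := ⟨_, rfl⟩
  have hβ : 1 / (2 * (d : ℝ)) ≤ 1 / 2 := by
    apply one_div_le_one_div_of_le <;> linarith
  have hβ0 : 0 < 1 / (2 * (d : ℝ)) := by positivity
  have hq0 : 0 < q := by linarith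
  have hq1 : q ≤ 1 := by linarith
  have hqd : 1 / 2 ≤ q ^ d := by
    have h := one_add_mul_le_pow (a := -(1 / (2 * (d : ℝ)))) (by linarith) d
    have h2 : 1 + (d : ℝ) * -(1 / (2 * (d : ℝ))) = 1 / 2 := by field_simp; ring
    rw [h2] at h
    rwa [hq, sub_eq_add_neg]
  -- Given that the events in `A` are avoided, event `i` is avoided with probability at least `q`.
  have key : ∀ n, ∀ A ⊆ S, A.card = n → ∀ i ∈ S, i ∉ A →
      q * (N A).card ≤ ((N (insert i A)).card : ℝ) := by
    intro n
    induction n using Nat.strong_induction_on with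
    | _ n ih =>
    intro A hA hAn i hi hiA
    let D := A.filter fun j => ¬ Disjoint (T i) (T j)
    let A' := A.filter fun j => Disjoint (T i) (T j)
    have hDA : A' ∪ D = A := Finset.filter_union_filter_not_eq _ _
    have hdisj : Disjoint A' D := Finset.disjoint_filter_filter_not _ _ _
    have hDd : D.card ≤ d := by
      refine le_trans (Finset.card_le_card fun j hj => ?_) (hdeg i hi)
      simp only [D, Finset.mem_filter] at hj ⊢
      exact ⟨hA hj.1, fun h => hiA (h ▸ hj.1), hj.2⟩
    -- Neighbours of `i` are added one at a time; `A' ∪ D'` still misses some `j ∈ A`, so the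
    -- induction hypothesis applies.
    have chain : ∀ D' ⊆ D, q ^ D'.card * (N A').card ≤ ((N (A' ∪ D')).card : ℝ) := by
      intro D'
      induction D' using Finset.induction_on with
      | empty => intro; simp
      | insert j D' hj ihD =>
        intro hsub
        have hjD : j ∈ D := hsub (Finset.mem_insert_self _ _)
        have hD'D : D' ⊆ D := (Finset.subset_insert _ _).trans hsub
        have hjA' : j ∉ A' ∪ D' := by
          rw [Finset.mem_union, not_or]
          exact ⟨fun h => Finset.disjoint_left.1 hdisj h hjD, hj⟩
        have hjA : j ∈ A := (Finset.mem_filter.1 hjD).1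
        have hsubA : A' ∪ D' ⊆ A := by
          rw [← hDA]; exact Finset.union_subset_union_right hD'D
        have hlt : (A' ∪ D').card < n := by
          rw [← hAn]
          exact Finset.card_lt_card ⟨hsubA, fun h => hjA' (h hjA)⟩
        have := ih _ hlt (A' ∪ D') (hsubA.trans hA) rfl j (hA hjA) hjA'
        rw [Finset.union_insert, Finset.card_insert_of_notMem hj, pow_succ]
        have h2 := mul_le_mul_of_nonneg_left (ihD hD'D) hq0.le
        nlinarith
    have h1 : (1 / 2) * ((N A').card : ℝ) ≤ (N A).card := by
      have h := chain D subset_rfl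
      rw [hDA] at h
      refine le_trans (mul_le_mul_of_nonneg_right ?_ (Nat.cast_nonneg _)) h
      exact hqd.trans (pow_le_pow_of_le_one hq0.le hq1 hDd)
    have h2 : ((B i ∩ N A').card : ℝ) * Fintype.card (W → α) = (B i).card * (N A').card := by
      exact_mod_cast card_inter_mul_card_univ_of_determined (T i) (B i) (N A') (hB i) (by
        intro x y hxy hx
        rw [memN] at hx ⊢
        intro j hj hyj
        refine hx j hj (hB j y x (fun v hv => (hxy v fun hvi => ?_).symm) hyj)
        exact Finset.disjoint_left.1 (Finset.mem_filter.1 hj).2 hvi hv)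
    have h3 : 4 * (d : ℝ) * (B i).card ≤ Fintype.card (W → α) := by exact_mod_cast hp i hi
    have h4 : 4 * (d : ℝ) * (B i ∩ N A').card ≤ (N A').card := by
      refine le_of_mul_le_mul_right ?_ hM
      calc 4 * (d : ℝ) * (B i ∩ N A').card * Fintype.card (W → α)
          = 4 * (d : ℝ) * (B i).card * (N A').card := by rw [mul_assoc, h2]; ring
        _ ≤ Fintype.card (W → α) * (N A').card :=
          mul_le_mul_of_nonneg_right h3 (Nat.cast_nonneg _)
        _ = _ := mul_comm _ _
    have h5 : ((N A).card : ℝ) ≤ (N (insert i A)).card + (B i ∩ N A').card := by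
      have : N A ⊆ N (insert i A) ∪ (B i ∩ N A') := by
        intro x hx
        rw [memN] at hx
        by_cases hxi : x ∈ B i
        · refine Finset.mem_union_right _ (Finset.mem_inter.2 ⟨hxi, (memN _ _).2 fun j hj => ?_⟩)
          exact hx j (Finset.mem_filter.1 hj).1
        · refine Finset.mem_union_left _ ((memN _ _).2 fun j hj => ?_)
          rcases Finset.mem_insert.1 hj with rfl | hj
          exacts [hxi, hx j hj]
      exact_mod_cast (Finset.card_le_card this).trans (Finset.card_union_le _ _)
    have h6 : ((B i ∩ N A').card : ℝ) ≤ 1 / (2 * d) * (N A).card := by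
      rw [div_mul_eq_mul_div, le_div_iff₀ (by positivity)]
      linarith
    rw [hq]
    linarith
  have pos : ∀ A ⊆ S, (0 : ℝ) < (N A).card := by
    intro A
    induction A using Finset.induction_on with
    | empty =>
      intro _
      have : N ∅ = Finset.univ := by ext; simp [N]
      rw [this, Finset.card_univ]; exact hM
    | insert i A hi ih =>
      intro hsub
      have hA : A ⊆ S := (Finset.subset_insert _ _).trans hsub
      exact (mul_pos hq0 (ih hA)).trans_le
        (key _ A hA rfl i (hsub (Finset.mem_insert_self _ _)) hi)
  obtain ⟨x, hx⟩ := Finset.card_pos.1 (Nat.cast_pos.1 (pos S subset_rfl))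
  exact ⟨x, (memN _ _).1 hx⟩

/-! ### Minimal transversals -/

/-- A subset `U` meeting every hyperedge, but no hyperedge in more than `d + 1` vertices. -/
theorem exists_transversal_card_inter_le {W : Type*} [Fintype W] [DecidableEq W]
    (𝓔 : Finset (Finset W)) (hne : ∀ E ∈ 𝓔, E.Nonempty) (d : ℕ)
    (hdeg : ∀ E ∈ 𝓔, (𝓔.filter fun F => F ≠ E ∧ ¬ Disjoint E F).card ≤ d) :
    ∃ U : Finset W, ∀ E ∈ 𝓔, (E ∩ U).Nonempty ∧ (E ∩ U).card ≤ d + 1 := by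
  obtain ⟨U, hU⟩ := Set.Finite.exists_minimal
    (s := {U : Finset W | ∀ E ∈ 𝓔, (E ∩ U).Nonempty}) (Set.toFinite _)
    ⟨Finset.univ, fun E hE => by simpa using hne E hE⟩
  have hpriv : ∀ u ∈ U, ∃ F ∈ 𝓔, F ∩ U = {u} := by
    intro u hu
    have h : ¬ ∀ E ∈ 𝓔, (E ∩ U.erase u).Nonempty := fun h =>
      Finset.notMem_erase u U (hU.2 h (Finset.erase_subset u U) hu)
    push Not at h
    obtain ⟨F, hF, hFe⟩ := h
    refine ⟨F, hF, ?_⟩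
    rw [Finset.inter_erase] at hFe
    rcases (Finset.erase_eq_empty_iff _ _).1 hFe with h0 | h0
    · exact absurd h0 (hU.1 F hF).ne_empty
    · exact h0
  choose! f hf hfU using hpriv
  refine ⟨U, fun E hE => ⟨hU.1 E hE, ?_⟩⟩
  have hinj : Set.InjOn f (E ∩ U : Finset W) := by
    intro u hu v hv huv
    have h := hfU u (Finset.mem_inter.1 hu).2
    rw [huv, hfU v (Finset.mem_inter.1 hv).2] at h
    exact (Finset.singleton_injective h).symm
  rw [← Finset.card_image_of_injOn hinj]
  -- The private edge `f u` contains `u ∈ E`, so it meets `E`; it may be `E` itself, whence the `+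
  -- 1`.
  have hsub : (E ∩ U).image f ⊆ insert E (𝓔.filter fun F => F ≠ E ∧ ¬ Disjoint E F) := by
    intro F hF
    obtain ⟨u, hu, rfl⟩ := Finset.mem_image.1 hF
    obtain ⟨huE, huU⟩ := Finset.mem_inter.1 hu
    have huf : u ∈ f u := by
      have : u ∈ f u ∩ U := by rw [hfU u huU]; simp
      exact (Finset.mem_inter.1 this).1
    by_cases h : f u = E
    · simp [h]
    · refine Finset.mem_insert_of_mem (Finset.mem_filter.2 ⟨hf u huU, h, ?_⟩)
      exact Finset.not_disjoint_iff.2 ⟨u, huE, huf⟩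
  exact (Finset.card_le_card hsub).trans
    ((Finset.card_insert_le _ _).trans (Nat.succ_le_succ (hdeg E hE)))

/-! ### Random markings -/

open Classical in
/-- If each vertex is marked with probability `1 / Q` and `Q / 4 ≤ #T ≤ Q / 2`, then exactly one
vertex of `T` is marked with probability at least `1 / 8`. -/
theorem card_le_eight_mul_card_existsUnique_eq_zero {W : Type*} [Fintype W] [DecidableEq W]
    (T : Finset W) (Q : ℕ) [NeZero Q] (h1 : Q ≤ 4 * T.card) (h2 : 2 * T.card ≤ Q) :
    Fintype.card (W → Fin Q) ≤
      8 * (Finset.univ.filter fun y : W → Fin Q => ∃! v, v ∈ T ∧ y v = 0).card := by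
  have hQ : (0 : ℝ) < Q := by exact_mod_cast NeZero.pos Q
  have hQ1 : 1 ≤ Q := NeZero.pos Q
  obtain ⟨r, hr⟩ : ∃ r : ℝ, r = 1 - 1 / Q := ⟨_, rfl⟩
  -- `G v` is the event that `v` is the only marked vertex of `T`. For `v ∈ T` these are disjoint,
  -- each of probability `(1 / Q) * r ^ (#T - 1) ≥ 1 / (2Q)`, and `#T ≥ Q / 4`.
  let G : W → Finset (W → Fin Q) := fun v => Fintype.piFinset fun w =>
    if w = v then {0} else if w ∈ T then {0}ᶜ else Finset.univ
  have memG : ∀ v y, y ∈ G v ↔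
      ∀ w, y w ∈ if w = v then {0} else if w ∈ T then {0}ᶜ else Finset.univ :=
    fun v y => Fintype.mem_piFinset
  have hG : ∀ v ∈ T, ((G v).card : ℝ) =
      (1 / Q) * r ^ (T.card - 1) * Fintype.card (W → Fin Q) := by
    intro v hv
    have hc : ((G v).card : ℝ) = ∏ w : W, ((if w = v then (1 / Q : ℝ) else 1) *
        (if w ∈ T.erase v then r else 1)) * Q := by
      rw [Fintype.card_piFinset, Nat.cast_prod]
      refine Finset.prod_congr rfl fun w _ => ?_
      by_cases hwv : w = v
      · simp [hwv, hQ.ne']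
      · by_cases hwT : w ∈ T
        · simp only [hwv, hwT, if_false, if_true, Finset.card_compl, Fintype.card_fin,
            Finset.card_singleton, Finset.mem_erase, ne_eq, not_false_eq_true, and_self]
          rw [Nat.cast_sub hQ1, hr]
          field_simp
          simp
        · simp [hwv, hwT]
    rw [hc, Finset.prod_mul_distrib, Finset.prod_mul_distrib, Finset.prod_ite_eq',
      Finset.prod_ite_mem, Finset.univ_inter, Finset.prod_const, Finset.prod_const,
      Finset.card_erase_of_mem hv]
    simp
  have hsub : T.biUnion G ⊆ Finset.univ.filter fun y : W → Fin Q => ∃! v, v ∈ T ∧ y v = 0 := by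
    intro y hy
    obtain ⟨v, hv, hyv⟩ := Finset.mem_biUnion.1 hy
    rw [memG] at hyv
    refine Finset.mem_filter.2 ⟨Finset.mem_univ _, v, ⟨hv, by simpa using hyv v⟩, ?_⟩
    rintro w ⟨hw, hyw⟩
    by_contra hwv
    have := hyv w
    simp [hwv, hw, hyw] at this
  have hdisj : (T : Set W).PairwiseDisjoint G := by
    intro u hu v _ huv
    refine Finset.disjoint_left.2 fun y hyu hyv => ?_
    rw [memG] at hyu hyv
    have h3 : y u = 0 := by simpa using hyu u
    have h4 := hyv u
    simp [huv, Finset.mem_coe.1 hu, h3] at h4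
  have hcard := Finset.card_le_card hsub
  rw [Finset.card_biUnion hdisj] at hcard
  have hcard' : (∑ v ∈ T, ((G v).card : ℝ)) ≤
      (Finset.univ.filter fun y : W → Fin Q => ∃! v, v ∈ T ∧ y v = 0).card := by
    exact_mod_cast hcard
  rw [Finset.sum_congr rfl hG, Finset.sum_const, nsmul_eq_mul] at hcard'
  have h1' : (Q : ℝ) ≤ 4 * T.card := by exact_mod_cast h1
  have h2' : 2 * (T.card : ℝ) ≤ Q := by exact_mod_cast h2
  have hrt : 1 / 2 ≤ r ^ (T.card - 1) := by
    have hq1 : (1 : ℝ) / Q ≤ 1 := by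
      rw [div_le_one hQ]; exact_mod_cast hQ1
    have h := one_add_mul_le_pow (a := -(1 / (Q : ℝ))) (by linarith) (T.card - 1)
    rw [hr, sub_eq_add_neg]
    refine le_trans ?_ h
    have h3 : ((T.card - 1 : ℕ) : ℝ) ≤ T.card := by exact_mod_cast Nat.sub_le _ _
    have h4 : ((T.card - 1 : ℕ) : ℝ) * (1 / Q) ≤ 1 / 2 := by
      rw [mul_one_div, div_le_iff₀ hQ]; linarith
    linarith
  have h5 : 1 ≤ 8 * (T.card * ((1 / Q : ℝ) * r ^ (T.card - 1))) := by
    have h6 : 1 / 4 ≤ (T.card : ℝ) * (1 / Q) := by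
      rw [mul_one_div, le_div_iff₀ hQ]; linarith
    nlinarith
  have h7 : (Fintype.card (W → Fin Q) : ℝ) ≤
      8 * (Finset.univ.filter fun y : W → Fin Q => ∃! v, v ∈ T ∧ y v = 0).card := by
    have := mul_le_mul_of_nonneg_right h5 (Nat.cast_nonneg (α := ℝ) (Fintype.card (W → Fin Q)))
    nlinarith
  exact_mod_cast h7

open Classical in
/-- Sets of comparable sizes, each meeting at most `d` others, can be hit exactly once by one of
logarithmically many sets of marked vertices. -/
theorem exists_marking_of_card_comparable {ι W : Type*} [DecidableEq ι] [Fintype W] [DecidableEq W]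
    (S : Finset ι) (T : ι → Finset W) (d : ℕ) (hd : 0 < d)
    (hdeg : ∀ i ∈ S, (S.filter fun j => j ≠ i ∧ ¬ Disjoint (T i) (T j)).card ≤ d)
    (Q : ℕ) [NeZero Q] (hQ : ∀ i ∈ S, Q ≤ 4 * (T i).card ∧ 2 * (T i).card ≤ Q)
    (P : ℕ) (hP : 4 * d * (7 / 8 : ℝ) ^ P ≤ 1) :
    ∃ M : Fin P → W → Prop, ∀ i ∈ S, ∃ p, ∃! v, v ∈ T i ∧ M p v := by
  let b : ι → Finset (W → Fin Q) := fun i =>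
    Finset.univ.filter fun y => ¬ ∃! v, v ∈ T i ∧ y v = 0
  let B : ι → Finset (W → Fin P → Fin Q) := fun i =>
    Finset.univ.filter fun x => ∀ p, ¬ ∃! v, v ∈ T i ∧ x v p = 0
  -- The `P` rounds are independent: transpose `W → Fin P → Fin Q`.
  have hBb : ∀ i, (B i).card = (b i).card ^ P := by
    intro i
    have : (B i).card = (Fintype.piFinset fun _ : Fin P => b i).card := by
      refine Finset.card_nbij' (fun x p w => x w p) (fun x w p => x p w) ?_ ?_ ?_ ?_
      · intro x hx
        simpa [B, b] using hx
      · intro x hx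
        simpa [B, b] using hx
      · intro x _; rfl
      · intro x _; rfl
    rw [this, Fintype.card_piFinset]
    simp
  obtain ⟨x, hx⟩ := exists_forall_notMem_of_card_le S T B (by
      intro i x y hxy hx
      simp only [B, Finset.mem_filter, Finset.mem_univ, true_and] at hx ⊢
      intro p h
      refine hx p ?_
      exact (existsUnique_congr fun v => and_congr_right fun hv => by rw [hxy v hv]).2 h) d hd hdeg (by
    intro i hi
    have h := card_le_eight_mul_card_existsUnique_eq_zero (T i) Q (hQ i hi).1 (hQ i hi).2
    have hsplit := Finset.card_filter_add_card_filter_not (s := (Finset.univ : Finset (W → Fin Q)))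
      (fun y => ∃! v, v ∈ T i ∧ y v = 0)
    rw [Finset.card_univ] at hsplit
    have hb : ((b i).card : ℝ) ≤ 7 / 8 * Fintype.card (W → Fin Q) := by
      have : 8 * (b i).card ≤ 7 * Fintype.card (W → Fin Q) := by
        simp only [b]; omega
      have : (8 : ℝ) * (b i).card ≤ 7 * Fintype.card (W → Fin Q) := by exact_mod_cast this
      linarith
    have hcard : Fintype.card (W → Fin P → Fin Q) = Fintype.card (W → Fin Q) ^ P := by
      simp [← pow_mul, mul_comm]
    rw [hcard, hBb]
    have : 4 * (d : ℝ) * (b i).card ^ P ≤ Fintype.card (W → Fin Q) ^ P := by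
      calc 4 * (d : ℝ) * (b i).card ^ P
          ≤ 4 * d * (7 / 8 * Fintype.card (W → Fin Q)) ^ P := by gcongr
        _ = 4 * d * (7 / 8) ^ P * Fintype.card (W → Fin Q) ^ P := by rw [mul_pow]; ring
        _ ≤ 1 * Fintype.card (W → Fin Q) ^ P := by gcongr
        _ = _ := one_mul _
    exact_mod_cast this)
  refine ⟨fun p v => x v p = 0, fun i hi => ?_⟩
  have := hx i hi
  simp only [B, Finset.mem_filter, Finset.mem_univ, true_and, not_forall, not_not] at this
  exact this

/-! ### Dyadic classes and constants -/

/-- If each member of a family of nonempty sets meets at most `Γ` others, then `O(log² Γ)` vertex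
sets suffice to meet each member of the family exactly once. -/
theorem exists_marking_of_card_intersecting_le {W : Type*} [Fintype W] [DecidableEq W]
    (𝓔 : Finset (Finset W)) (hne : ∀ E ∈ 𝓔, E.Nonempty) (Γ : ℝ) (hΓ : Real.exp 1 < Γ)
    (hdeg : ∀ E ∈ 𝓔, ((𝓔.filter fun F => F ≠ E ∧ ¬ Disjoint E F).card : ℝ) ≤ Γ) :
    ∃ N : ℕ, 0 < N ∧ (N : ℝ) ≤ 100 * Real.log Γ ^ 2 ∧
      ∃ M : Fin N → W → Prop, ∀ E ∈ 𝓔, ∃ p, ∃! v, v ∈ E ∧ M p v := by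
  have hΓ2 : 2 < Γ := by linarith [Real.exp_one_gt_d9]
  have hΓ0 : 0 < Γ := by linarith
  have hlog : 1 < Real.log Γ := (Real.lt_log_iff_exp_lt hΓ0).2 hΓ
  obtain ⟨d, hd⟩ : ∃ d, d = ⌊Γ⌋₊ := ⟨_, rfl⟩
  have hdΓ : (d : ℝ) ≤ Γ := hd ▸ Nat.floor_le hΓ0.le
  have hd2 : 2 ≤ d := hd ▸ Nat.le_floor (by exact_mod_cast hΓ2.le)
  have hd0 : (0 : ℝ) < d := by exact_mod_cast (by omega : 0 < d)
  have hdeg' : ∀ E ∈ 𝓔, (𝓔.filter fun F => F ≠ E ∧ ¬ Disjoint E F).card ≤ d :=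
    fun E hE => hd ▸ Nat.le_floor (hdeg E hE)
  obtain ⟨U, hU⟩ := exists_transversal_card_inter_le 𝓔 hne d hdeg'
  -- Since `7 / 8 ≤ exp (-1 / 8)`, this many rounds bring the failure probability down to `1 /
  -- (4d)`.
  obtain ⟨P, hPdef⟩ : ∃ P, P = ⌈8 * Real.log (4 * d)⌉₊ := ⟨_, rfl⟩
  have hlog4 : Real.log 4 < 1.4 := by
    rw [show (4 : ℝ) = 2 ^ 2 by norm_num, Real.log_pow]
    push_cast
    linarith [Real.log_two_lt_d9]
  have hlog4d : Real.log (4 * d) ≤ 1.4 + Real.log Γ := by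
    rw [Real.log_mul (by norm_num) hd0.ne']
    linarith [Real.log_le_log hd0 hdΓ]
  have hlog4d0 : 0 < Real.log (4 * d) := by
    have : (2 : ℝ) ≤ d := by exact_mod_cast hd2
    exact Real.log_pos (by linarith)
  have hP8 : 8 * Real.log (4 * d) ≤ P := hPdef ▸ Nat.le_ceil _
  have hPpos : 0 < P := hPdef ▸ Nat.ceil_pos.2 (by positivity)
  have hPle : (P : ℝ) ≤ 21 * Real.log Γ := by
    have := Nat.ceil_lt_add_one (a := 8 * Real.log (4 * d)) (by positivity)
    rw [← hPdef] at this
    linarith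
  have hP : 4 * d * (7 / 8 : ℝ) ^ P ≤ 1 := by
    have h1 : (7 / 8 : ℝ) ≤ Real.exp (-(1 / 8)) := by
      linarith [Real.add_one_le_exp (-(1 / 8 : ℝ))]
    have h2 : (7 / 8 : ℝ) ^ P ≤ Real.exp (-Real.log (4 * d)) := by
      refine (pow_le_pow_left₀ (by norm_num) h1 P).trans ?_
      rw [← Real.exp_nat_mul]
      exact Real.exp_le_exp.2 (by linarith)
    rw [Real.exp_neg, Real.exp_log (by positivity)] at h2
    calc 4 * d * (7 / 8 : ℝ) ^ P ≤ 4 * d * (4 * d : ℝ)⁻¹ := by gcongr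
      _ = 1 := mul_inv_cancel₀ (by positivity)
  obtain ⟨m, hm⟩ : ∃ m, m = Nat.log 2 (d + 1) + 1 := ⟨_, rfl⟩
  have hmle : (m : ℝ) ≤ 4 * Real.log Γ := by
    have h1 : ((2 ^ Nat.log 2 (d + 1) : ℕ) : ℝ) ≤ 2 * Γ := by
      have : ((2 ^ Nat.log 2 (d + 1) : ℕ) : ℝ) ≤ ((d + 1 : ℕ) : ℝ) :=
        Nat.cast_le.2 (Nat.pow_log_le_self 2 (by omega))
      push_cast at this ⊢
      linarith
    have h2 := Real.log_le_log (by positivity) h1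
    rw [Nat.cast_pow, Real.log_pow, Real.log_mul (by norm_num) hΓ0.ne'] at h2
    have h3 := Real.log_two_gt_d9
    have h4 := Real.log_two_lt_d9
    rw [hm]
    push_cast at h2 ⊢
    have h5 : (0 : ℝ) ≤ Nat.log 2 (d + 1) := Nat.cast_nonneg _
    nlinarith
  have hscale : ∀ k : Fin m, ∃ M : Fin P → W → Prop,
      ∀ E ∈ 𝓔.filter (fun E => Nat.log 2 (E ∩ U).card = k),
        ∃ p, ∃! v, v ∈ E ∩ U ∧ M p v := by
    intro k
    -- For `2 ^ k ≤ t < 2 ^ (k + 1)`, the choice `Q = 2 ^ (k + 2)` gives `Q ≤ 4t` and `2t ≤ Q`.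
    have : NeZero (2 ^ ((k : ℕ) + 2)) := ⟨by positivity⟩
    refine exists_marking_of_card_comparable _ (fun E => E ∩ U) d (by omega) ?_
      (2 ^ ((k : ℕ) + 2)) ?_ P hP
    · intro E hE
      refine (Finset.card_le_card fun F hF => ?_).trans (hdeg' E (Finset.mem_filter.1 hE).1)
      simp only [Finset.mem_filter] at hF ⊢
      exact ⟨hF.1.1, hF.2.1, fun h => hF.2.2
        (h.mono Finset.inter_subset_left Finset.inter_subset_left)⟩
    · intro E hE
      obtain ⟨hE, hk⟩ := Finset.mem_filter.1 hE
      have h1 := Nat.pow_log_le_self 2 (hU E hE).1.card_pos.ne'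
      have h2 := Nat.lt_pow_succ_log_self (b := 2) (by norm_num) (E ∩ U).card
      rw [hk] at h1 h2
      rw [pow_succ] at h2
      rw [pow_add]
      constructor <;> omega
  choose M hM using hscale
  refine ⟨m * P, Nat.mul_pos (by omega) hPpos, ?_,
    fun p v => v ∈ U ∧ M (finProdFinEquiv.symm p).1 (finProdFinEquiv.symm p).2 v, ?_⟩
  · push_cast
    have := mul_le_mul hmle hPle (Nat.cast_nonneg _) (by linarith)
    nlinarith
  · intro E hE
    have hk : Nat.log 2 (E ∩ U).card < m := by
      rw [hm]
      exact Nat.lt_succ_of_le (Nat.log_mono_right (hU E hE).2)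
    obtain ⟨p, hp⟩ := hM ⟨_, hk⟩ E (Finset.mem_filter.2 ⟨hE, rfl⟩)
    refine ⟨finProdFinEquiv (⟨_, hk⟩, p), ?_⟩
    simpa [and_assoc] using hp

/-! ### From markings to colorings -/

namespace Hypergraph

/-- Vertex sets meeting each hyperedge exactly once for some index give a conflict-free collection
of colorings with two colors each. -/
theorem cfCoveringNumber_le_of_marking {V : Type*} (H : Hypergraph V) (N : ℕ) (hN : 0 < N)
    (M : Fin N → H.vertexSet → Prop)
    (hM : ∀ E ∈ H.edgeSet, ∃ p, ∃! v : H.vertexSet, (v : V) ∈ E ∧ M p v) :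
    H.cfCoveringNumber ≤ ((2 * N : ℕ) : ℕ∞) := by
  classical
  let 𝒞 : H.ConflictFreeCollection 1 :=
    { P := N
      P_pos := hN
      L := fun _ => 2
      L_pos := fun _ => by norm_num
      C := fun p v => ⟨{if M p v then 1 else 0}, Finset.card_singleton _⟩
      conflictFree := by
        intro E hE
        obtain ⟨p, v, ⟨hv, hMv⟩, huniq⟩ := hM E hE
        refine ⟨p, v, hv, fun w hw hwv => ?_⟩
        have hMw : ¬ M p w := fun h => hwv (huniq w ⟨hw, h⟩)
        simp [hMv, hMw] }
  have h : 𝒞.totalColors = 2 * N := by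
    simp [ConflictFreeCollection.totalColors, 𝒞, mul_comm]
  rw [← h]
  exact iInf_le (fun 𝒞 : H.ConflictFreeCollection 1 => (𝒞.totalColors : ℕ∞)) 𝒞

end Hypergraph

theorem mainTheorem1 :
    ∃ K : ℝ, 0 < K ∧
      ∀ (V : Type*) (H : Hypergraph V) (Γ : ℝ),
        H.vertexSet.Finite →
        (∀ E ∈ H.edgeSet, E.Nonempty) →
        Real.exp 1 < Γ →
        (∀ E ∈ H.edgeSet, ((H.otherIntersecting E).ncard : ℝ) ≤ Γ) →
        ∃ n : ℕ, H.cfCoveringNumber = (n : ℕ∞) ∧ (n : ℝ) ≤ K * Real.log Γ ^ 2 := by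
  classical
  -- Two colors for each of at most `100 * log² Γ` markings.
  refine ⟨200, by norm_num, fun V H Γ hfin hne hΓ hdeg => ?_⟩
  have : Fintype H.vertexSet := hfin.fintype
  have hedge : H.edgeSet.Finite :=
    hfin.finite_subsets.subset fun E hE => H.subset_vertexSet_of_mem_edgeSet' hE
  let toSet : Finset H.vertexSet → Set V := fun E => (fun v : H.vertexSet => (v : V)) '' E
  have mem_toSet : ∀ (E : Finset H.vertexSet) (v : H.vertexSet), (v : V) ∈ toSet E ↔ v ∈ E := by
    intro E v
    simp [toSet]
  have toSet_inj : Function.Injective toSet := fun E F h => by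
    ext v
    rw [← mem_toSet, ← mem_toSet, h]
  let 𝓔 : Finset (Finset H.vertexSet) := Finset.univ.filter fun E => toSet E ∈ H.edgeSet
  obtain ⟨N, hN0, hN, M, hM⟩ := exists_marking_of_card_intersecting_le 𝓔 (by
      intro E hE
      simpa [toSet] using hne _ (Finset.mem_filter.1 hE).2) Γ hΓ (by
      intro E hE
      have hE' := (Finset.mem_filter.1 hE).2
      refine le_trans ?_ (hdeg _ hE')
      rw [← Finset.card_image_of_injective _ toSet_inj, ← Set.ncard_coe_finset]
      refine Nat.cast_le.2 (Set.ncard_le_ncard ?_ (hedge.subset fun F hF => hF.1))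
      intro F' hF'
      obtain ⟨F, hF, rfl⟩ := Finset.mem_image.1 (Finset.mem_coe.1 hF')
      obtain ⟨hF1, hF2, hF3⟩ := Finset.mem_filter.1 hF
      obtain ⟨v, hvE, hvF⟩ := Finset.not_disjoint_iff.1 hF3
      exact ⟨(Finset.mem_filter.1 hF1).2, fun h => hF2 (toSet_inj h),
        v, (mem_toSet _ _).2 hvE, (mem_toSet _ _).2 hvF⟩)
  have hle := H.cfCoveringNumber_le_of_marking N hN0 M (by
    intro E hE
    have hEs : toSet (Finset.univ.filter fun v : H.vertexSet => (v : V) ∈ E) = E := by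
      ext v
      have := H.subset_vertexSet_of_mem_edgeSet' hE
      simp only [toSet, Set.mem_image, Finset.coe_filter, Finset.mem_univ, true_and,
        Set.mem_ofPred_eq]
      exact ⟨fun ⟨w, hw, hwv⟩ => hwv ▸ hw, fun hv => ⟨⟨v, this hv⟩, hv, rfl⟩⟩
    obtain ⟨p, hp⟩ := hM _ (Finset.mem_filter.2 ⟨Finset.mem_univ _, hEs.symm ▸ hE⟩)
    exact ⟨p, by simpa using hp⟩)
  obtain ⟨n, hn⟩ := ENat.ne_top_iff_exists.1 (ne_top_of_le_ne_top (ENat.natCast_ne_top _) hle)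
  refine ⟨n, hn.symm, ?_⟩
  rw [← hn] at hle
  have : (n : ℝ) ≤ ((2 * N : ℕ) : ℝ) := Nat.cast_le.2 (by exact_mod_cast hle)
  push_cast at this
  linarith
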